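/- Let $p$ be a prime with $p\equiv 1$ or $9 \pmod{20}$. Then there are integers $M,N$ with $p=M^2+N^2$, $N$ even and $M\equiv 1\pmod 4$, and there are integers $A,B$ with $p=A^2+5B^2$. For every such pair $(M,N)$, exactly one of $M$ and $N$ is divisible by $5$; and for every such $(M,N)$ and every such $(A,B)$: (a) if $p\equiv 1\pmod{20}$, then $A$ is even if and only if $5\mid M$; (b) if $p\equiv 9\pmod{20}$, then $A$ is even if and only if $5\mid N$. -/

import Mathlib

/-!
Let `p = A ^ 2 + 5 * B ^ 2 = x ^ 2 + y ^ 2`, where `x` is whichever of `M`, `N` makes `A + x` odd.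
Then `(A + x) * (A - x) = y ^ 2 - 5 * B ^ 2` is a norm from `ℚ(√5)`. No prime divides both factors
on the left and `B`, so every prime inert in `ℚ(√5)` divides `A + x` to an even power and the Jacobi
symbol `(5 / |A + x|)` is `1` as soon as `5 ∤ A + x`. By quadratic reciprocity
`(A + x) ^ 2 ≡ 1 (mod 5)`. If `5 ∣ x` this says `p ≡ A ^ 2 ≡ 1 (mod 5)`; if `5 ∣ y`, then `A ≡ ± x`,
and with the sign of `x` chosen so that `A ≡ x` it says `4 * p ≡ (2 * A) ^ 2 ≡ 1`, that is
`p ≡ -1 (mod 5)`.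

The representation `p = A ^ 2 + 5 * B ^ 2` comes from Thue's lemma: `-5` is a square modulo `p`, so
`x ^ 2 + 5 * y ^ 2 = k * p` for some `0 < k < 6`, and congruences modulo `4` and `5` leave only
`k = 1, 4, 5`.
-/

open scoped NumberTheorySymbols

section JacobiSymbol

theorem jacobiSym_eq_one_of_dvd_sq_sub_mul_sq {n : ℕ} {d y z : ℤ} (hd : IsCoprime d n)
    (hz : IsCoprime z n) (h : (n : ℤ) ∣ y ^ 2 - d * z ^ 2) : J(d | n) = 1 := by
  have hy : IsCoprime y n := by
    obtain ⟨k, hk⟩ := h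
    have : IsCoprime (d * z ^ 2 + n * k) n :=
      (IsCoprime.mul_left hd hz.pow_left).add_mul_left_left k
    rwa [← hk, add_sub_cancel, IsCoprime.pow_left_iff two_pos] at this
  calc J(d | n) = J(d | n) * J(z | n) ^ 2 := by
        rw [jacobiSym.sq_one (Int.isCoprime_iff_gcd_eq_one.1 hz), mul_one]
    _ = J(d * z ^ 2 | n) := by rw [jacobiSym.mul_left, jacobiSym.pow_left]
    _ = J(y ^ 2 | n) := jacobiSym.mod_left' (Int.modEq_iff_dvd.2 h)
    _ = 1 := jacobiSym.sq_one' (Int.isCoprime_iff_gcd_eq_one.1 hy)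

theorem exists_eq_sq_mul_of_prime_dvd {d n m y z q : ℤ} (hq : Prime q) (hqn : q ∣ n) (hqz : q ∣ z)
    (hqm : ¬ q ∣ m) (h : n * m = y ^ 2 - d * z ^ 2) :
    ∃ n' y' z' : ℤ, n = q ^ 2 * n' ∧ z = q * z' ∧ n' * m = y' ^ 2 - d * z' ^ 2 := by
  have hqy : q ∣ y := by
    refine hq.dvd_of_dvd_pow (n := 2) ?_
    rw [show y ^ 2 = n * m + d * z ^ 2 by rw [h]; ring]
    exact dvd_add (hqn.mul_right m) ((dvd_pow hqz two_ne_zero).mul_left d)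
  obtain ⟨y', rfl⟩ := hqy
  obtain ⟨z', rfl⟩ := hqz
  have hq2 : q ^ 2 ∣ n * m := ⟨y' ^ 2 - d * z' ^ 2, by rw [h]; ring⟩
  obtain ⟨n', rfl⟩ := hq.pow_dvd_of_dvd_mul_right 2 hqm hq2
  refine ⟨n', y', z', rfl, rfl, mul_left_cancel₀ (pow_ne_zero 2 hq.ne_zero) ?_⟩
  linear_combination h

theorem jacobiSym_natAbs_eq_one_of_mul_eq {d n m y z : ℤ} (hd : IsCoprime d n)
    (h : n * m = y ^ 2 - d * z ^ 2) (hcop : ∀ q : ℤ, Prime q → q ∣ n → q ∣ m → ¬ q ∣ z) :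
    J(d | n.natAbs) = 1 := by
  induction hk : n.natAbs using Nat.strong_induction_on generalizing n y z with
  | _ k ih =>
  subst hk
  rcases eq_or_ne n 0 with rfl | hn
  · exact jacobiSym.zero_right d
  by_cases hz : IsCoprime n z
  · refine jacobiSym_eq_one_of_dvd_sq_sub_mul_sq (y := y) (z := z) ?_ ?_ ?_
    · rwa [Int.natCast_natAbs, IsCoprime.abs_right_iff]
    · rw [Int.natCast_natAbs, IsCoprime.abs_right_iff]
      exact hz.symm
    · exact Int.natAbs_dvd.2 ⟨m, h.symm⟩
  obtain ⟨q, hq, hqn, hqz⟩ : ∃ q : ℤ, Prime q ∧ q ∣ n ∧ q ∣ z := by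
    by_contra! H
    exact hz (isCoprime_of_prime_dvd (fun h0 => hn h0.1) H)
  obtain ⟨n', y', z', rfl, rfl, h'⟩ :=
    exists_eq_sq_mul_of_prime_dvd hq hqn hqz (fun hqm => hcop q hq hqn hqm hqz) h
  have hn' : n' ≠ 0 := right_ne_zero_of_mul hn
  have hdq : d.gcd q.natAbs = 1 := by
    rw [← Int.isCoprime_iff_gcd_eq_one, Int.natCast_natAbs, IsCoprime.abs_right_iff]
    exact hd.of_isCoprime_of_dvd_right hqn
  have hlt : n'.natAbs < (q ^ 2 * n').natAbs := by
    rw [Int.natAbs_mul, Int.natAbs_pow]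
    exact lt_mul_left (Int.natAbs_pos.2 hn')
      (one_lt_pow₀ (Int.prime_iff_natAbs_prime.1 hq).one_lt two_ne_zero)
  have hJ : J(d | n'.natAbs) = 1 :=
    ih _ hlt hd.of_mul_right_right h'
      (fun r hr hrn hrm hrz => hcop r hr (hrn.mul_left _) hrm (hrz.mul_left _)) rfl
  rw [Int.natAbs_mul, Int.natAbs_pow, jacobiSym.mul_right' _
    (pow_ne_zero 2 (Int.natAbs_ne_zero.2 hq.ne_zero)) (Int.natAbs_ne_zero.2 hn'),
    jacobiSym.pow_right, jacobiSym.sq_one hdq, hJ, one_mul]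

theorem jacobiSym_natAbs_add_eq_one {d A B x y : ℤ} (hAB : IsCoprime A B)
    (h : A ^ 2 + d * B ^ 2 = x ^ 2 + y ^ 2) (hodd : Odd (A + x)) (hd : IsCoprime d (A + x)) :
    J(d | (A + x).natAbs) = 1 := by
  have hmul : (A + x) * (A - x) = y ^ 2 - d * B ^ 2 := by linear_combination h
  refine jacobiSym_natAbs_eq_one_of_mul_eq hd hmul fun q hq hadd hsub hB => ?_
  have h2A : q ∣ 2 * A := by
    rw [show 2 * A = A + x + (A - x) by ring]
    exact dvd_add hadd hsub
  rcases hq.dvd_or_dvd h2A with h2 | hA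
  · exact hq.not_isUnit ((Int.isCoprime_two_left.2 hodd).isUnit_of_dvd' h2 hadd)
  · exact hq.not_isUnit (hAB.isUnit_of_dvd' hA hB)

theorem jacobiSym_five_natAbs {a : ℤ} (ha : Odd a) :
    ((J(5 | a.natAbs) : ℤ) : ZMod 5) = (a : ZMod 5) ^ 2 := by
  have : Fact (Nat.Prime 5) := ⟨Nat.prime_five⟩
  have hrec : J(5 | a.natAbs) = legendreSym 5 a.natAbs := by
    rw [jacobiSym.legendreSym.to_jacobiSym]
    exact jacobiSym.quadratic_reciprocity_one_mod_four (a := 5) rfl (Int.natAbs_odd.2 ha)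
  rw [hrec, legendreSym.eq_pow, ← Int.cast_pow, ← Int.cast_pow]
  exact congrArg _ (Int.natAbs_sq a)

end JacobiSymbol

section TwoRepresentations

theorem isRelPrime_of_squarefree_sq_add_mul_sq {R : Type*} [CommSemiring R] {d a b : R}
    (h : Squarefree (a ^ 2 + d * b ^ 2)) : IsRelPrime a b := by
  intro c hca hcb
  refine h c ?_
  rw [← sq]
  exact dvd_add (pow_dvd_pow_of_dvd hca 2) ((pow_dvd_pow_of_dvd hcb 2).mul_left d)

variable {n A B M N x y : ℤ}

theorem add_sq_eq_one_zmod_five (hcop : IsCoprime A B) (h : A ^ 2 + 5 * B ^ 2 = x ^ 2 + y ^ 2)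
    (hodd : Odd (A + x)) (h5 : (A + x : ZMod 5) ≠ 0) : (A + x : ZMod 5) ^ 2 = 1 := by
  have hcop5 : IsCoprime 5 (A + x) := by
    have hprime : Prime (5 : ℤ) := by norm_num
    refine hprime.coprime_iff_not_dvd.2 fun hdvd => h5 ?_
    exact_mod_cast (ZMod.intCast_zmod_eq_zero_iff_dvd (A + x) 5).2 hdvd
  have hsymbol := jacobiSym_five_natAbs hodd
  rw [jacobiSym_natAbs_add_eq_one hcop h hodd hcop5] at hsymbol
  exact_mod_cast hsymbol.symm

theorem sq_eq_intCast_zmod_five (h : n = A ^ 2 + 5 * B ^ 2) : (A : ZMod 5) ^ 2 = n := by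
  rw [h]
  push_cast
  rw [show (5 : ZMod 5) = 0 from rfl, zero_mul, add_zero]

theorem intCast_eq_one_of_five_dvd_left (hcop : IsCoprime A B) (hAB : n = A ^ 2 + 5 * B ^ 2)
    (hxy : n = x ^ 2 + y ^ 2) (hodd : Odd (A + x)) (hn : (n : ZMod 5) ≠ 0) (hx : 5 ∣ x) :
    (n : ZMod 5) = 1 := by
  have hx0 : (x : ZMod 5) = 0 := (ZMod.intCast_zmod_eq_zero_iff_dvd x 5).2 hx
  have hA : (A : ZMod 5) ^ 2 = n := sq_eq_intCast_zmod_five hAB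
  have hA0 : (A : ZMod 5) ≠ 0 := fun h => hn (by rw [← hA, h, zero_pow two_ne_zero])
  have hsq := add_sq_eq_one_zmod_five hcop (hAB.symm.trans hxy) hodd (by rwa [hx0, add_zero])
  rwa [hx0, add_zero, hA] at hsq

theorem intCast_eq_neg_one_of_intCast_eq (hcop : IsCoprime A B) (hAB : n = A ^ 2 + 5 * B ^ 2)
    (hxy : n = x ^ 2 + y ^ 2) (hodd : Odd (A + x)) (hn : (n : ZMod 5) ≠ 0)
    (hAx : (A : ZMod 5) = x) : (n : ZMod 5) = -1 := by
  have h2 : (2 : ZMod 5) ≠ 0 := by decide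
  have : Fact (Nat.Prime 5) := ⟨Nat.prime_five⟩
  have hA : (A : ZMod 5) ^ 2 = n := sq_eq_intCast_zmod_five hAB
  have hA0 : (A : ZMod 5) ≠ 0 := fun h => hn (by rw [← hA, h, zero_pow two_ne_zero])
  have h2A : (A + x : ZMod 5) = 2 * A := by rw [← hAx, two_mul]
  have h2A0 : (2 * A : ZMod 5) ≠ 0 := mul_ne_zero h2 hA0
  have hsq := add_sq_eq_one_zmod_five hcop (hAB.symm.trans hxy) hodd (by rwa [h2A])
  have h4n : (-1 : ZMod 5) * n = 1 := by
    rwa [h2A, mul_pow, hA, show (2 : ZMod 5) ^ 2 = -1 from rfl] at hsq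
  rw [← h4n, neg_one_mul, neg_neg]

theorem intCast_eq_neg_one_of_five_dvd_right (hcop : IsCoprime A B) (hAB : n = A ^ 2 + 5 * B ^ 2)
    (hxy : n = x ^ 2 + y ^ 2) (hodd : Odd (A + x)) (hn : (n : ZMod 5) ≠ 0) (hy : 5 ∣ y) :
    (n : ZMod 5) = -1 := by
  have : Fact (Nat.Prime 5) := ⟨Nat.prime_five⟩
  have hsq : (A : ZMod 5) ^ 2 = (x : ZMod 5) ^ 2 := by
    have hy0 : (y : ZMod 5) = 0 := (ZMod.intCast_zmod_eq_zero_iff_dvd y 5).2 hy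
    rw [sq_eq_intCast_zmod_five hAB, hxy, Int.cast_add, Int.cast_pow, Int.cast_pow, hy0,
      zero_pow two_ne_zero, add_zero]
  rcases sq_eq_sq_iff_eq_or_eq_neg.1 hsq with hAx | hAx
  · exact intCast_eq_neg_one_of_intCast_eq hcop hAB hxy hodd hn hAx
  · have hodd' : Odd (A + -x) := by
      rw [← sub_eq_add_neg]
      exact Int.odd_sub.2 (Int.odd_add.1 hodd)
    have hxy' : n = (-x) ^ 2 + y ^ 2 := by rwa [neg_sq]
    exact intCast_eq_neg_one_of_intCast_eq hcop hAB hxy' hodd' hn (by rw [hAx, Int.cast_neg])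

theorem xor_five_dvd_of_eq_sq_add_sq (h : n = M ^ 2 + N ^ 2)
    (hn : (n : ZMod 5) = 1 ∨ (n : ZMod 5) = -1) : Xor (5 ∣ M) (5 ∣ N) := by
  have key : ∀ a b : ZMod 5, a ^ 2 + b ^ 2 = 1 ∨ a ^ 2 + b ^ 2 = -1 → Xor (a = 0) (b = 0) := by
    unfold Xor
    decide
  have hxor := key M N (by exact_mod_cast h ▸ hn)
  rwa [ZMod.intCast_zmod_eq_zero_iff_dvd M 5, ZMod.intCast_zmod_eq_zero_iff_dvd N 5] at hxor

theorem even_iff_five_dvd_left (hcop : IsCoprime A B) (hAB : n = A ^ 2 + 5 * B ^ 2)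
    (hMN : n = M ^ 2 + N ^ 2) (hM : Odd M) (hN : Even N) (hn : (n : ZMod 5) = 1) :
    Even A ↔ 5 ∣ M := by
  have hn0 : (n : ZMod 5) ≠ 0 := by rw [hn]; decide
  have hne : (n : ZMod 5) ≠ -1 := by rw [hn]; decide
  constructor
  · intro hA
    have h5N : ¬ 5 ∣ N := fun h5 =>
      hne (intCast_eq_neg_one_of_five_dvd_right hcop hAB hMN (hA.add_odd hM) hn0 h5)
    exact (xor_five_dvd_of_eq_sq_add_sq hMN (.inl hn)).or.resolve_right h5N
  · intro h5M
    by_contra hA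
    exact hne (intCast_eq_neg_one_of_five_dvd_right hcop hAB (hMN.trans (add_comm _ _))
      ((Int.not_even_iff_odd.1 hA).add_even hN) hn0 h5M)

theorem even_iff_five_dvd_right (hcop : IsCoprime A B) (hAB : n = A ^ 2 + 5 * B ^ 2)
    (hMN : n = M ^ 2 + N ^ 2) (hM : Odd M) (hN : Even N) (hn : (n : ZMod 5) = -1) :
    Even A ↔ 5 ∣ N := by
  have hn0 : (n : ZMod 5) ≠ 0 := by rw [hn]; decide
  have hne : (n : ZMod 5) ≠ 1 := by rw [hn]; decide
  constructor
  · intro hA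
    have h5M : ¬ 5 ∣ M := fun h5 =>
      hne (intCast_eq_one_of_five_dvd_left hcop hAB hMN (hA.add_odd hM) hn0 h5)
    exact (xor_five_dvd_of_eq_sq_add_sq hMN (.inr hn)).or.resolve_left h5M
  · intro h5N
    by_contra hA
    exact hne (intCast_eq_one_of_five_dvd_left hcop hAB (hMN.trans (add_comm _ _))
      ((Int.not_even_iff_odd.1 hA).add_even hN) hn0 h5N)

end TwoRepresentations

section Existence

theorem exists_abs_le_and_intCast_eq_mul {n a b : ℕ} [NeZero n] (hn : n < (a + 1) * (b + 1))
    (r : ZMod n) :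
    ∃ x y : ℤ, (x ≠ 0 ∨ y ≠ 0) ∧ |x| ≤ a ∧ |y| ≤ b ∧ (x : ZMod n) = r * y := by
  have hcard : (Finset.univ : Finset (ZMod n)).card <
      (Finset.range (a + 1) ×ˢ Finset.range (b + 1)).card := by
    rwa [Finset.card_univ, ZMod.card, Finset.card_product, Finset.card_range, Finset.card_range]
  obtain ⟨⟨u, v⟩, huv, ⟨u', v'⟩, huv', hne, heq⟩ :=
    Finset.exists_ne_map_eq_of_card_lt_of_maps_to hcard
      (f := fun w : ℕ × ℕ => (w.1 : ZMod n) - r * w.2) fun _ _ => Finset.mem_univ _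
  simp only [Finset.mem_product, Finset.mem_range] at huv huv'
  refine ⟨u - u', v - v', ?_, abs_le.2 (by omega), abs_le.2 (by omega), ?_⟩
  · by_contra! h
    exact hne (Prod.ext (by omega) (by omega))
  · push_cast
    linear_combination heq

theorem exists_sq_add_mul_sq_eq_mul {n d : ℕ} (hn : ¬ IsSquare n) (hd : d ≠ 0)
    (hsq : IsSquare (-d : ZMod n)) :
    ∃ x y k : ℤ, 0 < k ∧ k < d + 1 ∧ x ^ 2 + d * y ^ 2 = k * n := by
  have : NeZero n := ⟨by rintro rfl; exact hn IsSquare.zero⟩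
  obtain ⟨r, hr⟩ := hsq
  obtain ⟨x, y, hne, hx, hy, hxy⟩ := exists_abs_le_and_intCast_eq_mul (Nat.lt_succ_sqrt n) r
  have sq_lt {z : ℤ} (hz : |z| ≤ n.sqrt) : z ^ 2 < n := by
    have hsqrt : n.sqrt ^ 2 < n := (Nat.sqrt_le' n).lt_of_ne fun h => hn ⟨n.sqrt, by rw [← sq, h]⟩
    calc z ^ 2 ≤ (n.sqrt : ℤ) ^ 2 := sq_le_sq.2 (by rwa [Nat.abs_cast])
      _ < n := by exact_mod_cast hsqrt
  obtain ⟨k, hk⟩ : (n : ℤ) ∣ x ^ 2 + d * y ^ 2 := by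
    rw [← ZMod.intCast_zmod_eq_zero_iff_dvd]
    push_cast
    rw [hxy]
    linear_combination -(y : ZMod n) ^ 2 * hr
  have hn0 : (0 : ℤ) < n := by exact_mod_cast Nat.pos_of_neZero n
  have hpos : 0 < x ^ 2 + d * y ^ 2 := by rcases hne with h | h <;> positivity
  refine ⟨x, y, k, ?_, ?_, by rw [hk, mul_comm]⟩
  · exact pos_of_mul_pos_right (hk ▸ hpos) hn0.le
  · refine lt_of_mul_lt_mul_left ?_ hn0.le
    rw [← hk]
    nlinarith [sq_lt hx, sq_lt hy]

theorem isSquare_neg_five_zmod {p : ℕ} [Fact p.Prime] (hp4 : p % 4 = 1)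
    (hp5 : p % 5 = 1 ∨ p % 5 = 4) : IsSquare (-5 : ZMod p) := by
  have hp : IsSquare (p : ZMod 5) := by
    rw [← ZMod.natCast_mod]
    rcases hp5 with h | h <;> rw [h] <;> decide
  have : Fact (Nat.Prime 5) := ⟨Nat.prime_five⟩
  have h5 : IsSquare (5 : ZMod p) := by
    exact_mod_cast (ZMod.exists_sq_eq_prime_iff_of_mod_four_eq_one (p := 5) rfl (by omega)).1 hp
  have hneg : IsSquare (-1 : ZMod p) := ZMod.exists_sq_eq_neg_one_iff.2 (by omega)
  rw [← neg_one_mul]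
  exact hneg.mul h5

theorem exists_eq_sq_add_five_mul_sq_of_mul_eq {n k x y : ℤ} (hn : n % 5 = 1 ∨ n % 5 = 4)
    (hk : 0 < k) (hk6 : k < 6) (h : x ^ 2 + 5 * y ^ 2 = k * n) :
    ∃ A B : ℤ, n = A ^ 2 + 5 * B ^ 2 := by
  have sq_mod_five (z : ℤ) : z ^ 2 % 5 = 0 ∨ z ^ 2 % 5 = 1 ∨ z ^ 2 % 5 = 4 := by
    rcases (by omega : z % 5 = 0 ∨ z % 5 = 1 ∨ z % 5 = 2 ∨ z % 5 = 3 ∨ z % 5 = 4) with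
      h | h | h | h | h <;> simp [pow_two, Int.mul_emod, h]
  have sq_mod_four (z : ℤ) : z ^ 2 % 4 = z % 2 := by
    rcases Int.even_or_odd' z with ⟨c, rfl | rfl⟩ <;> ring_nf <;> omega
  have hx5 := sq_mod_five x
  interval_cases k
  · exact ⟨x, y, by linarith⟩
  · omega
  · omega
  · have hx4 := sq_mod_four x
    have hy4 := sq_mod_four y
    obtain ⟨a, rfl⟩ : 2 ∣ x := by omega
    obtain ⟨b, rfl⟩ : 2 ∣ y := by omega
    exact ⟨a, b, by linarith⟩
  · obtain ⟨a, rfl⟩ : 5 ∣ x := 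
      (by norm_num : Prime (5 : ℤ)).dvd_of_dvd_pow (n := 2) (by omega)
    exact ⟨y, a, by linarith⟩

theorem exists_eq_sq_add_five_mul_sq {p : ℕ} (hp : p.Prime) (hp4 : p % 4 = 1)
    (hp5 : p % 5 = 1 ∨ p % 5 = 4) : ∃ A B : ℤ, (p : ℤ) = A ^ 2 + 5 * B ^ 2 := by
  have : Fact p.Prime := ⟨hp⟩
  obtain ⟨x, y, k, hk, hk6, h⟩ := exists_sq_add_mul_sq_eq_mul hp.prime.not_isSquare
    (d := 5) (by decide) (by exact_mod_cast isSquare_neg_five_zmod hp4 hp5)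
  exact exists_eq_sq_add_five_mul_sq_of_mul_eq (by omega) hk hk6 (by exact_mod_cast h)

theorem exists_eq_sq_add_sq_of_mod_four_eq_one {p : ℕ} (hp : p.Prime) (hp4 : p % 4 = 1) :
    ∃ M N : ℤ, (p : ℤ) = M ^ 2 + N ^ 2 ∧ Even N ∧ M ≡ 1 [ZMOD 4] := by
  have : Fact p.Prime := ⟨hp⟩
  obtain ⟨a, b, hab, ha, hb⟩ : ∃ a b : ℤ, (p : ℤ) = a ^ 2 + b ^ 2 ∧ Odd a ∧ Even b := by
    obtain ⟨a, b, hab⟩ := Nat.Prime.sq_add_sq (p := p) (by omega)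
    have hodd : Odd (a ^ 2 + b ^ 2) := by rw [hab, Nat.odd_iff]; omega
    rw [Nat.odd_add, Nat.odd_pow_iff two_ne_zero, Nat.even_pow' two_ne_zero] at hodd
    rcases Nat.even_or_odd b with hb | hb
    · exact ⟨a, b, by exact_mod_cast hab.symm, by exact_mod_cast hodd.2 hb, by exact_mod_cast hb⟩
    · have ha : Even a := Nat.not_odd_iff_even.1 fun ha => Nat.not_even_iff_odd.2 hb (hodd.1 ha)
      exact ⟨b, a, by rw [add_comm]; exact_mod_cast hab.symm, by exact_mod_cast hb,
        by exact_mod_cast ha⟩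
  rcases (by rw [Int.odd_iff] at ha; omega : a % 4 = 1 ∨ a % 4 = 3) with h | h
  · exact ⟨a, b, hab, hb, h⟩
  · exact ⟨-a, b, by rw [neg_sq, hab], hb, by unfold Int.ModEq; omega⟩

end Existence

theorem mainTheorem9 (p : ℕ) (hp : p.Prime) (hmod : p ≡ 1 [MOD 20] ∨ p ≡ 9 [MOD 20]) :
    (∃ M N : ℤ, (p : ℤ) = M ^ 2 + N ^ 2 ∧ Even N ∧ M ≡ 1 [ZMOD 4]) ∧
    (∃ A B : ℤ, (p : ℤ) = A ^ 2 + 5 * B ^ 2) ∧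
    (∀ M N : ℤ, (p : ℤ) = M ^ 2 + N ^ 2 → Even N → M ≡ 1 [ZMOD 4] →
      Xor ((5 : ℤ) ∣ M) ((5 : ℤ) ∣ N) ∧
      ∀ A B : ℤ, (p : ℤ) = A ^ 2 + 5 * B ^ 2 →
        (p ≡ 1 [MOD 20] → (Even A ↔ (5 : ℤ) ∣ M)) ∧
        (p ≡ 9 [MOD 20] → (Even A ↔ (5 : ℤ) ∣ N))) := by
  have hp4 : p % 4 = 1 := by unfold Nat.ModEq at hmod; omega
  have hp5 : p % 5 = 1 ∨ p % 5 = 4 := by unfold Nat.ModEq at hmod; omega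
  have h1 (h : p ≡ 1 [MOD 20]) : ((p : ℤ) : ZMod 5) = 1 := by
    exact_mod_cast (ZMod.natCast_eq_natCast_iff p 1 5).2 (h.of_dvd (by decide))
  have h9 (h : p ≡ 9 [MOD 20]) : ((p : ℤ) : ZMod 5) = -1 := by
    exact_mod_cast (ZMod.natCast_eq_natCast_iff p 9 5).2 (h.of_dvd (by decide))
  refine ⟨exists_eq_sq_add_sq_of_mod_four_eq_one hp hp4,
    exists_eq_sq_add_five_mul_sq hp hp4 hp5, fun M N hMN hN hM => ?_⟩
  refine ⟨xor_five_dvd_of_eq_sq_add_sq hMN (hmod.imp h1 h9), fun A B hAB => ?_⟩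
  have hM_odd : Odd M := Int.odd_iff.2 (by unfold Int.ModEq at hM; omega)
  have hcop : IsCoprime A B := by
    refine (isRelPrime_of_squarefree_sq_add_mul_sq (d := 5) ?_).isCoprime
    rw [← hAB]
    exact (Nat.prime_iff_prime_int.1 hp).squarefree
  exact ⟨fun h => even_iff_five_dvd_left hcop hAB hMN hM_odd hN (h1 h),
    fun h => even_iff_five_dvd_right hcop hAB hMN hM_odd hN (h9 h)⟩
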